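/- **Asymptotic normality of the ridge IV estimator (fixed instruments).** Consider the linear IV model with one instrument $$Y_i=\beta_0+\beta_1 D_i+\epsilon_i,\qquad D_i=\pi_0+\pi_1 Z_i+\eta_i ,\qquad i\ge 1,$$ with $\pi_1\neq 0$. The error pairs $(\epsilon_i,\eta_i)$ are i.i.d. across $i$ with finite variances; $\epsilon_i$ and $\eta_i$ may be correlated with each other. (Their means need not be zero, since they can be absorbed into the intercepts.) Write $\sigma_\epsilon^2=\mathrm{Var}(\epsilon_i)$. The instruments $Z_i$ are fixed real constants, normalised so that $\frac1n\sum_{i=1}^n Z_i\to 0$ and $\frac1n\sum_{i=1}^n Z_i^2\to 1$. For a real sequence $\lambda_n$ with $\lambda_n=o(\sqrt n)$ let $$\hat\beta_{\mathrm{ridge}}=\frac{\sum_{i=1}^n (Y_i-\bar Y)(Z_i-\bar Z)}{\sum_{i=1}^n (D_i-\bar D)(Z_i-\bar Z)+\lambda_n},$$ where bars denote sample means over the first $n$ observations. Then, in distribution, $$\sqrt n\,(\hat\beta_{\mathrm{ridge}}-\beta_1)\;\longrightarrow\;\mathcal N\!\left(0,\frac{\sigma_\epsilon^2}{\pi_1^2}\right).$$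 This is the same limit as for the two-stage least squares estimator $\hat\beta_{\mathrm{2SLS}}$ (the case $\lambda_n=0$): also $\sqrt n\,(\hat\beta_{\mathrm{2SLS}}-\beta_1)\to\mathcal N(0,\sigma_\epsilon^2/\pi_1^2)$ in distribution. -/

import Mathlib

open Filter MeasureTheory ProbabilityTheory Asymptotics
open scoped Topology

noncomputable section

/-- The sample mean of the first `n` observations `x 0, …, x (n - 1)`. -/
def sampleMean (n : ℕ) (x : ℕ → ℝ) : ℝ :=
  (∑ i ∈ Finset.range n, x i) / n

/-- The sample covariance (normalised by `n`) of the first `n` observations. -/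
def sampleCov (n : ℕ) (x y : ℕ → ℝ) : ℝ :=
  (∑ i ∈ Finset.range n, (x i - sampleMean n x) * (y i - sampleMean n y)) / n

/-- The ridge IV estimator from the first `n` observations of outcome `y`, endogenous variable `d`
and instrument `z`, with penalty `lam`. -/
def ridgeIV (n : ℕ) (lam : ℝ) (y d z : ℕ → ℝ) : ℝ :=
  (∑ i ∈ Finset.range n, (y i - sampleMean n y) * (z i - sampleMean n z)) /
    ((∑ i ∈ Finset.range n, (d i - sampleMean n d) * (z i - sampleMean n z)) + lam)

/-- The two-stage least squares estimator with a single instrument and an intercept. -/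
def tsls (n : ℕ) (y d z : ℕ → ℝ) : ℝ :=
  (∑ i ∈ Finset.range n, (y i - sampleMean n y) * (z i - sampleMean n z)) /
    (∑ i ∈ Finset.range n, (d i - sampleMean n d) * (z i - sampleMean n z))

/-- The ridge estimator as a ratio of sample covariances. -/
theorem ridgeIV_eq_sampleCov (n : ℕ) (lam : ℝ) (y d z : ℕ → ℝ) :
    ridgeIV n lam y d z = sampleCov n y z / (sampleCov n d z + lam / n) := by
  rcases Nat.eq_zero_or_pos n with rfl | hn
  · simp [ridgeIV, sampleCov]
  · have h : (n : ℝ) ≠ 0 := by positivity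
    rw [ridgeIV, sampleCov, sampleCov, ← add_div, div_div_div_cancel_right₀ h]

end

/-! Put `w i = Z i - sampleMean n Z`. These weights sum to zero, so intercepts and error means drop
out. Whenever the denominator is nonzero, `√n (ridgeIV - β₁)` is exactly the quotient of `n^(-1/2) ∑
w i ε i - β₁ λ_n / √n` by `π₁ n⁻¹ ∑ (w i)² + λ_n / n + n⁻¹ ∑ w i η i`
(`sqrt_mul_ridgeIV_sub_eq_div`).

The first sum is asymptotically `N(0, σ_ε²)` by a central limit theorem for weighted sums
(`tendstoInDistribution_weighted_sum`), and the penalty term beside it vanishes because `λ_n =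
o(√n)`. The denominator tends to `π₁` in probability by Chebyshev's inequality
(`tendstoInMeasure_weighted_sum`). Slutsky's theorem then gives the limit; as the denominator has a
constant limit, correlation between `ε i` and `η i` does not matter.

The weights `w i / √n` are uniformly small because convergence of the averages of `Z i ^ 2` forces
the largest of the first `n` squares to be `o(n)`. -/

/-! ### Central limit theorem for weighted sums, by characteristic functions. -/

section CentralLimit

/-- The characteristic functions of two laws with the same first two moments agree to second order
at the origin. -/
lemma isLittleO_charFun_sub_charFun {μ ν : Measure ℝ} [IsProbabilityMeasure μ]
    [IsProbabilityMeasure ν] (hμ : MemLp id 2 μ) (hν : MemLp id 2 ν)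
    (h1 : ∫ x, x ∂μ = ∫ x, x ∂ν) (h2 : ∫ x, x ^ 2 ∂μ = ∫ x, x ^ 2 ∂ν) :
    (fun t => charFun μ t - charFun ν t) =o[𝓝 0] fun t : ℝ => t ^ 2 := by
  -- The Taylor coefficients up to degree 2 are given by the moments of order 0, 1 and 2, which
  -- agree.
  have key : ∀ t, taylorWithinEval (charFun μ) 2 Set.univ 0 t =
      taylorWithinEval (charFun ν) 2 Set.univ 0 t := fun t => by
    rw [taylorWithinEval_charFun_zero hμ, taylorWithinEval_charFun_zero hν]
    refine Finset.sum_congr rfl fun k hk => ?_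
    congr 2
    rw [Finset.mem_range] at hk
    interval_cases k <;> simp [h1, h2]
  have a := taylor_isLittleO_univ (x₀ := 0) (contDiff_charFun (n := 2) hμ)
  have b := taylor_isLittleO_univ (x₀ := 0) (contDiff_charFun (n := 2) hν)
  have c := a.sub b
  simp only [sub_zero, key, sub_sub_sub_cancel_right] at c
  exact c

/-- Telescoping: exchanging one factor at a time costs at most the difference of the two factors,
since all the others have norm at most 1. -/
lemma norm_prod_sub_prod_le_sum {ι : Type*} (s : Finset ι) (f g : ι → ℂ)
    (hf : ∀ i ∈ s, ‖f i‖ ≤ 1) (hg : ∀ i ∈ s, ‖g i‖ ≤ 1) :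
    ‖∏ i ∈ s, f i - ∏ i ∈ s, g i‖ ≤ ∑ i ∈ s, ‖f i - g i‖ := by
  classical
  induction s using Finset.induction_on with
  | empty => simp
  | insert a s ha ih =>
    rw [Finset.prod_insert ha, Finset.prod_insert ha, Finset.sum_insert ha]
    have hf' : ‖∏ i ∈ s, f i‖ ≤ 1 := by
      rw [norm_prod]
      exact Finset.prod_le_one (fun _ _ => norm_nonneg _)
        fun i hi => hf i (Finset.mem_insert_of_mem hi)
    have e : f a * ∏ i ∈ s, f i - g a * ∏ i ∈ s, g i =
        (f a - g a) * ∏ i ∈ s, f i + g a * (∏ i ∈ s, f i - ∏ i ∈ s, g i) := by ring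
    rw [e]
    refine (norm_add_le _ _).trans (add_le_add ?_ ?_)
    · rw [norm_mul]
      exact mul_le_of_le_one_right (norm_nonneg _) hf'
    · rw [norm_mul]
      exact (mul_le_of_le_one_left (norm_nonneg _) (hg a (Finset.mem_insert_self a s))).trans
        (ih (fun i hi => hf i (Finset.mem_insert_of_mem hi))
          fun i hi => hg i (Finset.mem_insert_of_mem hi))

/-- If two characteristic functions agree to second order at the origin, then so asymptotically do
their products over a uniformly negligible triangular array with bounded sum of squares. -/
lemma tendsto_prod_charFun_sub_prod_charFun {μ ν : Measure ℝ} [IsProbabilityMeasure μ]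
    [IsProbabilityMeasure ν]
    (h : (fun t => charFun μ t - charFun ν t) =o[𝓝 0] fun t : ℝ => t ^ 2)
    {a : ℕ → ℕ → ℝ} {v : ℝ}
    (ha : Tendsto (fun n => ∑ i ∈ Finset.range n, a n i ^ 2) atTop (𝓝 v))
    (hmax : ∀ δ > 0, ∀ᶠ n in atTop, ∀ i ∈ Finset.range n, |a n i| ≤ δ) (t : ℝ) :
    Tendsto (fun n => ∏ i ∈ Finset.range n, charFun μ (a n i * t) -
      ∏ i ∈ Finset.range n, charFun ν (a n i * t)) atTop (𝓝 0) := by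
  rw [Metric.tendsto_nhds]
  intro δ hδ
  -- `|v| + 1` eventually bounds the sum of squares; the final `+ 1` keeps `K` positive and the last
  -- estimate strict even when `t = 0`.
  set K : ℝ := (|v| + 1) * t ^ 2 + 1 with hK
  have hKpos : 0 < K := by positivity
  obtain ⟨r, hr, hball⟩ := Metric.eventually_nhds_iff.1 (h.def (c := δ / K) (by positivity))
  have hsum : ∀ᶠ n in atTop, ∑ i ∈ Finset.range n, a n i ^ 2 < |v| + 1 :=
    ha.eventually_lt_const ((le_abs_self v).trans_lt (lt_add_one _))
  filter_upwards [hsum, hmax (r / (|t| + 1)) (by positivity)] with n hn hmn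
  rw [dist_zero_right]
  refine (norm_prod_sub_prod_le_sum _ _ _ (fun _ _ => norm_charFun_le_one _)
    (fun _ _ => norm_charFun_le_one _)).trans_lt ?_
  calc ∑ i ∈ Finset.range n, ‖charFun μ (a n i * t) - charFun ν (a n i * t)‖
      ≤ ∑ i ∈ Finset.range n, δ / K * (a n i ^ 2 * t ^ 2) := by
        refine Finset.sum_le_sum fun i hi => ?_
        have hd : dist (a n i * t) 0 < r := by
          rw [dist_zero_right, Real.norm_eq_abs, abs_mul]
          calc |a n i| * |t| ≤ r / (|t| + 1) * |t| := by gcongr; exact hmn i hi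
            _ < r / (|t| + 1) * (|t| + 1) := by gcongr; exact lt_add_one _
            _ = r := by field_simp
        have := hball hd
        rwa [Real.norm_of_nonneg (by positivity), mul_pow] at this
    _ = δ / K * ((∑ i ∈ Finset.range n, a n i ^ 2) * t ^ 2) := by
        rw [← Finset.mul_sum, Finset.sum_mul]
    _ ≤ δ / K * ((|v| + 1) * t ^ 2) := by gcongr
    _ < δ / K * K := by gcongr; exact lt_add_one _
    _ = δ := by field_simp

variable {Ω Ω' : Type*} [MeasurableSpace Ω] [MeasurableSpace Ω'] {P : Measure Ω}
  [IsProbabilityMeasure P] {P' : Measure Ω'} [IsProbabilityMeasure P']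

/-- **Central limit theorem for weighted sums** of centred i.i.d. variables with a uniformly
negligible triangular array of weights. -/
theorem tendstoInDistribution_weighted_sum {X : ℕ → Ω → ℝ} {G : Ω' → ℝ}
    (hG : HasLaw G (gaussianReal 0 Var[X 0; P].toNNReal) P')
    (hX : MemLp (X 0) 2 P) (h0 : P[X 0] = 0) (hindep : iIndepFun X P)
    (hident : ∀ i, IdentDistrib (X i) (X 0) P P) {a : ℕ → ℕ → ℝ}
    (ha : Tendsto (fun n => ∑ i ∈ Finset.range n, a n i ^ 2) atTop (𝓝 1))
    (hmax : ∀ δ > 0, ∀ᶠ n in atTop, ∀ i ∈ Finset.range n, |a n i| ≤ δ) :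
    TendstoInDistribution (fun n ω => ∑ i ∈ Finset.range n, a n i * X i ω) atTop G
      (fun _ => P) P' where
  forall_aemeasurable n :=
    Finset.aemeasurable_fun_sum _ fun i _ => (hident i).aemeasurable_fst.const_mul _
  aemeasurable_limit := hG.aemeasurable
  tendsto := by
    have mX i := (hident i).aemeasurable_fst
    refine ProbabilityMeasure.tendsto_iff_tendsto_charFun.2 fun t => ?_
    rw! [hG.map_eq]
    simp only [ProbabilityMeasure.coe_mk]
    set v := Var[X 0; P].toNNReal with hv
    have hv' : (v : ℝ) = P[X 0 ^ 2] := by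
      rw [hv, Real.coe_toNNReal _ (variance_nonneg _ _),
        variance_of_integral_eq_zero (mX 0) h0]
      rfl
    have : IsProbabilityMeasure (P.map (X 0)) := Measure.isProbabilityMeasure_map (mX 0)
    have hμ : MemLp id 2 (P.map (X 0)) :=
      (memLp_map_measure_iff (by fun_prop) (mX 0)).2 hX
    have hlo := isLittleO_charFun_sub_charFun (μ := P.map (X 0)) (ν := gaussianReal 0 v) hμ
      (memLp_id_gaussianReal 2) (by
        rw [integral_id_gaussianReal, integral_map (mX 0) (by fun_prop), h0]) (by
        rw [integral_map (mX 0) (by fun_prop)]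
        have := variance_fun_id_gaussianReal (μ := 0) (v := v)
        rw [variance_of_integral_eq_zero (by fun_prop) integral_id_gaussianReal] at this
        rw [this, hv']; rfl)
    have hprod : ∀ n, charFun (P.map fun ω => ∑ i ∈ Finset.range n, a n i * X i ω) t =
        ∏ i ∈ Finset.range n, charFun (P.map (X 0)) (a n i * t) := fun n => by
      have hi : iIndepFun (fun i ω => a n i * X i ω) P :=
        hindep.comp (fun i x => a n i * x) fun _ => by fun_prop
      rw [(hi.restrict _).charFun_map_fun_finsetSum_eq_prod fun i _ => (mX i).const_mul _,
        Finset.prod_apply]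
      refine Finset.prod_congr rfl fun i _ => ?_
      rw [charFun_map_mul_comp (mX i), (hident i).map_eq]
    -- For the Gaussian the product is explicit and sees the weights only through their sum of
    -- squares.
    have hgauss : ∀ n, ∏ i ∈ Finset.range n, charFun (gaussianReal 0 v) (a n i * t) =
        Complex.exp (-(v * t ^ 2 / 2) * (∑ i ∈ Finset.range n, a n i ^ 2 : ℝ)) := fun n => by
      simp only [charFun_gaussianReal, ← Complex.exp_sum]
      push_cast
      rw [Finset.mul_sum]
      congr 1
      exact Finset.sum_congr rfl fun i _ => by ring
    have hlim : Tendsto (fun n => ∏ i ∈ Finset.range n, charFun (gaussianReal 0 v) (a n i * t))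
        atTop (𝓝 (charFun (gaussianReal 0 v) t)) := by
      simp only [hgauss]
      have hc : charFun (gaussianReal 0 v) t =
          Complex.exp (-(v * t ^ 2 / 2) * ((1 : ℝ) : ℂ)) := by
        rw [charFun_gaussianReal]; congr 1; push_cast; ring
      rw [hc]
      exact (Complex.continuous_exp.tendsto _).comp
        (((Complex.continuous_ofReal.tendsto _).comp ha).const_mul _)
    simpa [hprod] using (tendsto_prod_charFun_sub_prod_charFun hlo ha hmax t).add hlim

end CentralLimit

/-! ### Slutsky's theorem for quotients and a weak law of large numbers. -/

section Slutsky

variable {Ω Ω' : Type*} [MeasurableSpace Ω] [MeasurableSpace Ω'] {P : Measure Ω}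
  [IsProbabilityMeasure P] {P' : Measure Ω'} [IsProbabilityMeasure P']

omit [IsProbabilityMeasure P] in
/-- Continuous mapping for convergence in probability to a constant. -/
lemma MeasureTheory.TendstoInMeasure.comp_continuousAt_const {ι E F : Type*} {l : Filter ι}
    [PseudoMetricSpace E] [PseudoMetricSpace F] {Y : ι → Ω → E} {c : E}
    (h : TendstoInMeasure P Y l fun _ => c) {f : E → F} (hf : ContinuousAt f c) :
    TendstoInMeasure P (fun i ω => f (Y i ω)) l fun _ => f c := by
  rw [tendstoInMeasure_iff_dist] at h ⊢
  intro δ hδ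
  obtain ⟨r, hr, hball⟩ := Metric.continuousAt_iff.1 hf δ hδ
  refine tendsto_of_tendsto_of_tendsto_of_le_of_le tendsto_const_nhds (h r hr)
    (fun _ => zero_le) fun i => measure_mono fun ω hω => ?_
  by_contra hlt
  exact absurd (hball (not_le.1 hlt)) (not_lt.2 hω)

/-- **Slutsky's theorem for quotients**: the denominators may vanish with probability tending to
zero, where nothing is required of `T`. -/
lemma MeasureTheory.TendstoInDistribution.div_of_tendstoInMeasure_const {ι : Type*} {l : Filter ι}
    [l.IsCountablyGenerated]
    {X Y T : ι → Ω → ℝ} {G : Ω' → ℝ} {c : ℝ} (hc : c ≠ 0)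
    (hX : TendstoInDistribution X l G (fun _ => P) P')
    (hY : TendstoInMeasure P Y l fun _ => c) (hYm : ∀ i, AEMeasurable (Y i) P)
    (hTm : ∀ i, AEMeasurable (T i) P)
    (hT : ∀ᶠ i in l, ∀ ω, Y i ω ≠ 0 → T i ω = X i ω / Y i ω) :
    TendstoInDistribution T l (fun ω => G ω / c) (fun _ => P) P' := by
  -- The map `g` has to be continuous everywhere, so it is multiplication, applied to the inverses
  -- of the denominators; inversion need only be continuous at `c`.
  have h := hX.continuous_comp_prodMk_of_tendstoInMeasure_const (g := fun p : ℝ × ℝ => p.1 * p.2)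
    (by fun_prop) (hY.comp_continuousAt_const (continuousAt_inv₀ hc)) fun i => (hYm i).inv
  refine tendstoInDistribution_of_tendstoInMeasure_sub _ _ h ?_ hTm
  rw [tendstoInMeasure_iff_dist] at hY ⊢
  intro δ hδ
  -- `T` can differ from `X * Y⁻¹` only where `Y = 0`, and there `Y` is at distance exactly `|c|`
  -- from `c`.
  refine tendsto_of_tendsto_of_tendsto_of_le_of_le' tendsto_const_nhds (hY |c| (abs_pos.2 hc))
    (.of_forall fun _ => zero_le) ?_
  filter_upwards [hT] with i hi
  refine measure_mono fun ω hω => ?_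
  by_cases h0 : Y i ω = 0
  · simp [h0, Real.dist_eq]
  · simp only [Set.mem_ofPred_eq, Pi.sub_apply, hi ω h0, div_eq_mul_inv, sub_self, Pi.zero_apply,
      dist_self] at hω
    exact absurd hω (not_le.2 hδ)

/-- **Weak law of large numbers for weighted sums** of centred i.i.d. square-integrable
variables. -/
lemma tendstoInMeasure_weighted_sum {X : ℕ → Ω → ℝ} (hX : MemLp (X 0) 2 P) (h0 : P[X 0] = 0)
    (hindep : iIndepFun X P) (hident : ∀ i, IdentDistrib (X i) (X 0) P P) {a : ℕ → ℕ → ℝ}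
    (ha : Tendsto (fun n => ∑ i ∈ Finset.range n, a n i ^ 2) atTop (𝓝 0)) :
    TendstoInMeasure P (fun n ω => ∑ i ∈ Finset.range n, a n i * X i ω) atTop fun _ => 0 := by
  have hm : ∀ i, MemLp (X i) 2 P := fun i => (hident i).memLp_iff.2 hX
  have hmem : ∀ n i, MemLp (fun ω => a n i * X i ω) 2 P := fun n i => (hm i).const_mul _
  have hE : ∀ n, P[fun ω => ∑ i ∈ Finset.range n, a n i * X i ω] = 0 := fun n => by
    rw [integral_finsetSum _ fun i _ => (hmem n i).integrable (by norm_num)]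
    refine Finset.sum_eq_zero fun i _ => ?_
    rw [integral_const_mul, (hident i).integral_eq, h0, mul_zero]
  have hV : ∀ n, Var[fun ω => ∑ i ∈ Finset.range n, a n i * X i ω; P] =
      (∑ i ∈ Finset.range n, a n i ^ 2) * Var[X 0; P] := fun n => by
    have := IndepFun.variance_sum (μ := P) (X := fun i ω => a n i * X i ω) (s := Finset.range n)
      (fun i _ => hmem n i) fun i _ j _ hij =>
        (hindep.indepFun hij).comp (φ := fun x => a n i * x) (ψ := fun x => a n j * x)
          (by fun_prop) (by fun_prop)
    rw [Finset.sum_fn] at this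
    rw [this, Finset.sum_mul]
    exact Finset.sum_congr rfl fun i _ => by rw [variance_const_mul, (hident i).variance_eq]
  rw [tendstoInMeasure_iff_norm]
  intro δ hδ
  have hlim : Tendsto (fun n => ENNReal.ofReal
      ((∑ i ∈ Finset.range n, a n i ^ 2) * Var[X 0; P] / δ ^ 2)) atTop (𝓝 0) := by
    have := ENNReal.tendsto_ofReal ((ha.mul_const Var[X 0; P]).div_const (δ ^ 2))
    simpa using this
  refine tendsto_of_tendsto_of_tendsto_of_le_of_le tendsto_const_nhds hlim
    (fun _ => zero_le) fun n => ?_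
  have := meas_ge_le_variance_div_sq
    (memLp_finsetSum (Finset.range n) fun i _ => hmem n i) hδ
  rw [hE, hV] at this
  exact this

end Slutsky

/-! ### Centred sums and negligibility of the standardised instruments. -/

section Instruments

lemma sum_sub_sampleMean (n : ℕ) (z : ℕ → ℝ) :
    ∑ i ∈ Finset.range n, (z i - sampleMean n z) = 0 := by
  rcases Nat.eq_zero_or_pos n with rfl | hn
  · simp
  · have h : (n : ℝ) ≠ 0 := by positivity
    rw [Finset.sum_sub_distrib, Finset.sum_const, Finset.card_range, nsmul_eq_mul, sampleMean,
      mul_div_cancel₀ _ h, sub_self]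

/-- Centring one factor suffices, because the centred weights annihilate constants. This turns the
estimator's sums into weighted sums linear in `x`. -/
lemma sum_sub_sampleMean_mul_sub_sampleMean (n : ℕ) (x z : ℕ → ℝ) :
    ∑ i ∈ Finset.range n, (x i - sampleMean n x) * (z i - sampleMean n z) =
      ∑ i ∈ Finset.range n, (z i - sampleMean n z) * x i := by
  calc ∑ i ∈ Finset.range n, (x i - sampleMean n x) * (z i - sampleMean n z)
      = ∑ i ∈ Finset.range n, ((z i - sampleMean n z) * x i -
          sampleMean n x * (z i - sampleMean n z)) := Finset.sum_congr rfl fun i _ => by ring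
    _ = _ := by
      rw [Finset.sum_sub_distrib, ← Finset.mul_sum, sum_sub_sampleMean, mul_zero, sub_zero]

lemma sum_sub_sampleMean_sq (n : ℕ) (z : ℕ → ℝ) :
    ∑ i ∈ Finset.range n, (z i - sampleMean n z) ^ 2 =
      ∑ i ∈ Finset.range n, z i ^ 2 - n * sampleMean n z ^ 2 := by
  have h : ∑ i ∈ Finset.range n, z i = n * sampleMean n z := by
    have := sum_sub_sampleMean n z
    rw [Finset.sum_sub_distrib, Finset.sum_const, Finset.card_range, nsmul_eq_mul] at this
    linarith
  simp only [sub_sq, Finset.sum_add_distrib, Finset.sum_sub_distrib, ← Finset.sum_mul,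
    ← Finset.mul_sum, h, Finset.sum_const, Finset.card_range, nsmul_eq_mul]
  ring

/-- If the Cesàro means of `u` converge, then `max (u 0) … (u (n - 1)) = o(n)`. -/
lemma eventually_forall_range_le_mul_of_tendsto_average {u : ℕ → ℝ} {c : ℝ}
    (h : Tendsto (fun n : ℕ => (∑ i ∈ Finset.range n, u i) / (n : ℝ)) atTop (𝓝 c)) {δ : ℝ}
    (hδ : 0 < δ) : ∀ᶠ n : ℕ in atTop, ∀ i ∈ Finset.range n, u i ≤ δ * n := by
  -- With `A n` the average of the first `n` terms, `u n / n = A (n + 1) * (1 + 1 / n) - A n`.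
  have h1 : Tendsto (fun n : ℕ => u n / n) atTop (𝓝 0) := by
    have hr : Tendsto (fun n : ℕ => 1 + 1 / (n : ℝ)) atTop (𝓝 1) := by
      simpa using tendsto_one_div_atTop_nhds_zero_nat (𝕜 := ℝ).const_add 1
    have := ((h.comp (tendsto_add_atTop_nat 1)).mul hr).sub h
    rw [mul_one, sub_self] at this
    refine this.congr' ?_
    filter_upwards [eventually_gt_atTop 0] with n hn
    have : (n : ℝ) ≠ 0 := by positivity
    simp only [Function.comp_apply, Finset.sum_range_succ]
    push_cast
    field_simp
    ring
  obtain ⟨N, hN⟩ := eventually_atTop.1 (h1.eventually_lt_const hδ)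
  have h2 : Tendsto (fun n : ℕ => δ * (n : ℝ)) atTop atTop :=
    tendsto_natCast_atTop_atTop.const_mul_atTop hδ
  -- The finitely many early terms lie below a fixed sum, which `δ * n` eventually exceeds; later
  -- ones satisfy `u i ≤ δ * i ≤ δ * n`. Cutting at `N + 1` ensures `i > 0` for the division.
  filter_upwards [h2.eventually_ge_atTop (∑ i ∈ Finset.range (N + 1), |u i|)] with n hn i hi
  rw [Finset.mem_range] at hi
  rcases lt_or_ge i (N + 1) with hlt | hge
  · exact ((le_abs_self _).trans (Finset.single_le_sum (f := fun i => |u i|)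
      (fun _ _ => abs_nonneg _) (Finset.mem_range.2 hlt))).trans hn
  · have hpos : (0 : ℝ) < i := by exact_mod_cast (by omega : 0 < i)
    have := (div_lt_iff₀ hpos).1 (hN i (by omega))
    refine this.le.trans ?_
    gcongr

variable {Z : ℕ → ℝ}

lemma tendsto_sum_sq_sub_sampleMean_div
    (hZ_mean : Tendsto (fun n : ℕ => (∑ i ∈ Finset.range n, Z i) / (n : ℝ)) atTop (𝓝 0))
    (hZ_sq : Tendsto (fun n : ℕ => (∑ i ∈ Finset.range n, Z i ^ 2) / (n : ℝ)) atTop (𝓝 1)) :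
    Tendsto (fun n : ℕ => (∑ i ∈ Finset.range n, (Z i - sampleMean n Z) ^ 2) / (n : ℝ)) atTop
      (𝓝 1) := by
  have := hZ_sq.sub (hZ_mean.pow 2)
  norm_num at this
  refine this.congr' ?_
  filter_upwards [eventually_gt_atTop 0] with n hn
  have : (n : ℝ) ≠ 0 := by positivity
  rw [sum_sub_sampleMean_sq, sub_div, mul_div_cancel_left₀ _ this, sampleMean]

/-- The standardised instruments are uniformly negligible. -/
lemma eventually_abs_sub_sampleMean_div_sqrt_le
    (hZ_mean : Tendsto (fun n : ℕ => (∑ i ∈ Finset.range n, Z i) / (n : ℝ)) atTop (𝓝 0))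
    (hZ_sq : Tendsto (fun n : ℕ => (∑ i ∈ Finset.range n, Z i ^ 2) / (n : ℝ)) atTop (𝓝 1))
    (δ : ℝ) (hδ : 0 < δ) :
    ∀ᶠ n : ℕ in atTop, ∀ i ∈ Finset.range n, |(Z i - sampleMean n Z) / √n| ≤ δ := by
  have hb : ∀ᶠ n : ℕ in atTop, |sampleMean n Z| ≤ δ / 2 := by
    have := hZ_mean.abs
    rw [abs_zero] at this
    exact (this.eventually_lt_const (half_pos hδ)).mono fun n hn => hn.le
  filter_upwards [eventually_forall_range_le_mul_of_tendsto_average hZ_sq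
    (show 0 < (δ / 2) ^ 2 by positivity), hb, eventually_ge_atTop 1] with n h1 h2 hn i hi
  have hs : 1 ≤ √(n : ℝ) := Real.one_le_sqrt.2 (by exact_mod_cast hn)
  have h3 : |Z i| ≤ δ / 2 * √n := by
    refine abs_le_of_sq_le_sq ?_ (by positivity)
    rw [mul_pow, Real.sq_sqrt (by positivity)]
    exact h1 i hi
  rw [abs_div, abs_of_pos (by positivity : 0 < √(n : ℝ)), div_le_iff₀ (by positivity)]
  calc |Z i - sampleMean n Z| ≤ |Z i| + |sampleMean n Z| := abs_sub _ _
    _ ≤ δ / 2 * √n + δ / 2 * √n := by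
      gcongr
      exact h2.trans (le_mul_of_one_le_right (by positivity) hs)
    _ = δ * √n := by ring

end Instruments

/-! ### The estimation error as a quotient, and its limit. -/

section RidgeIV

variable {Ω : Type*} [MeasurableSpace Ω] {P : Measure Ω} [IsProbabilityMeasure P]

lemma tendstoInMeasure_const_of_tendsto {c : ℕ → ℝ} {x : ℝ} (h : Tendsto c atTop (𝓝 x)) :
    TendstoInMeasure P (fun n _ => c n) atTop fun _ => x :=
  tendstoInMeasure_of_tendsto_ae (fun _ => aestronglyMeasurable_const) (.of_forall fun _ => h)

omit [IsProbabilityMeasure P] in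
lemma MeasureTheory.TendstoInMeasure.const_add_of_tendsto {Y : ℕ → Ω → ℝ} {y c : ℝ} {d : ℕ → ℝ}
    (hY : TendstoInMeasure P Y atTop fun _ => y) (hd : Tendsto d atTop (𝓝 c)) :
    TendstoInMeasure P (fun n ω => d n + Y n ω) atTop fun _ => c + y := by
  rw [tendstoInMeasure_iff_dist] at hY ⊢
  intro δ hδ
  refine tendsto_of_tendsto_of_tendsto_of_le_of_le' tendsto_const_nhds (hY (δ / 2) (half_pos hδ))
    (.of_forall fun _ => zero_le) ?_
  filter_upwards [Metric.tendsto_nhds.1 hd (δ / 2) (half_pos hδ)] with n hn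
  refine measure_mono fun ω (hω : δ ≤ dist (d n + Y n ω) (c + y)) => ?_
  have := dist_add_add_le (d n) (Y n ω) c y
  change δ / 2 ≤ dist (Y n ω) y
  linarith

/-- The scaled estimation error of the ridge estimator as a quotient. -/
lemma sqrt_mul_ridgeIV_sub_eq_div {n : ℕ} (hn : 0 < n) {β₀ β₁ π₀ π₁ : ℝ} {lam : ℝ}
    {Z y d e h : ℕ → ℝ} (hy : ∀ i, y i = β₀ + β₁ * d i + e i)
    (hd : ∀ i, d i = π₀ + π₁ * Z i + h i)
    (h0 : π₁ * ((∑ i ∈ Finset.range n, (Z i - sampleMean n Z) ^ 2) / n) + lam / n +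
      ∑ i ∈ Finset.range n, (Z i - sampleMean n Z) / n * h i ≠ 0) :
    √(n : ℝ) * (ridgeIV n lam y d Z - β₁) =
      (∑ i ∈ Finset.range n, (Z i - sampleMean n Z) / √n * e i + -(lam / √n * β₁)) /
      (π₁ * ((∑ i ∈ Finset.range n, (Z i - sampleMean n Z) ^ 2) / n) + lam / n +
        ∑ i ∈ Finset.range n, (Z i - sampleMean n Z) / n * h i) := by
  have hn' : (n : ℝ) ≠ 0 := by positivity
  have hs : √(n : ℝ) ≠ 0 := by positivity
  have hss : √(n : ℝ) * √n = n := Real.mul_self_sqrt (by positivity)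
  set w : ℕ → ℝ := fun i => Z i - sampleMean n Z with hw
  have hw0 : ∑ i ∈ Finset.range n, w i = 0 := sum_sub_sampleMean n Z
  have hzz : ∑ i ∈ Finset.range n, w i * Z i = ∑ i ∈ Finset.range n, w i ^ 2 := by
    rw [← sum_sub_sampleMean_mul_sub_sampleMean]
    exact Finset.sum_congr rfl fun i _ => (pow_two _).symm
  have hSd : ∑ i ∈ Finset.range n, w i * d i =
      π₁ * ∑ i ∈ Finset.range n, w i ^ 2 + ∑ i ∈ Finset.range n, w i * h i := by
    rw [← hzz]
    calc ∑ i ∈ Finset.range n, w i * d i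
        = ∑ i ∈ Finset.range n, (π₀ * w i + π₁ * (w i * Z i) + w i * h i) :=
          Finset.sum_congr rfl fun i _ => by rw [hd]; ring
      _ = _ := by
        rw [Finset.sum_add_distrib, Finset.sum_add_distrib, ← Finset.mul_sum, ← Finset.mul_sum,
          hw0, mul_zero, zero_add]
  have hSy : ∑ i ∈ Finset.range n, w i * y i =
      β₁ * ∑ i ∈ Finset.range n, w i * d i + ∑ i ∈ Finset.range n, w i * e i := by
    calc ∑ i ∈ Finset.range n, w i * y i
        = ∑ i ∈ Finset.range n, (β₀ * w i + β₁ * (w i * d i) + w i * e i) :=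
          Finset.sum_congr rfl fun i _ => by rw [hy]; ring
      _ = _ := by
        rw [Finset.sum_add_distrib, Finset.sum_add_distrib, ← Finset.mul_sum, ← Finset.mul_sum,
          hw0, mul_zero, zero_add]
  have hden : π₁ * ((∑ i ∈ Finset.range n, w i ^ 2) / n) + lam / n +
      ∑ i ∈ Finset.range n, w i / n * h i = (∑ i ∈ Finset.range n, w i * d i + lam) / n := by
    simp only [div_mul_eq_mul_div, ← Finset.sum_div, hSd]
    ring
  have hnum : ∑ i ∈ Finset.range n, w i / √n * e i + -(lam / √n * β₁) =
      (∑ i ∈ Finset.range n, w i * e i - lam * β₁) / √n := by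
    simp only [div_mul_eq_mul_div, ← Finset.sum_div]
    ring
  change π₁ * ((∑ i ∈ Finset.range n, w i ^ 2) / n) + lam / n +
      ∑ i ∈ Finset.range n, w i / n * h i ≠ 0 at h0
  change _ = (∑ i ∈ Finset.range n, w i / √n * e i + -(lam / √n * β₁)) /
    (π₁ * ((∑ i ∈ Finset.range n, w i ^ 2) / n) + lam / n + ∑ i ∈ Finset.range n, w i / n * h i)
  rw [hden] at h0 ⊢
  -- With `n > 0`, the hypothesis on the scaled denominator says that the estimator's own
  -- denominator is nonzero, so fractions can be cleared.
  have hS : ∑ i ∈ Finset.range n, w i * d i + lam ≠ 0 := fun hz => h0 (by rw [hz, zero_div])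
  rw [hnum, ridgeIV, sum_sub_sampleMean_mul_sub_sampleMean, sum_sub_sampleMean_mul_sub_sampleMean]
  change √(n : ℝ) * ((∑ i ∈ Finset.range n, w i * y i) /
    (∑ i ∈ Finset.range n, w i * d i + lam) - β₁) = _
  rw [hSy, div_sub' hS, div_div_div_eq, ← mul_div_assoc, div_eq_div_iff hS (mul_ne_zero hs hS)]
  linear_combination (∑ i ∈ Finset.range n, w i * e i - lam * β₁) *
    (∑ i ∈ Finset.range n, w i * d i + lam) * hss

theorem tendstoInDistribution_sqrt_mul_ridgeIV_sub
    {β₀ β₁ π₀ π₁ : ℝ} (hπ₁ : π₁ ≠ 0) {Z : ℕ → ℝ} {ε η Y D : ℕ → Ω → ℝ}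
    (hY : ∀ i ω, Y i ω = β₀ + β₁ * D i ω + ε i ω)
    (hD : ∀ i ω, D i ω = π₀ + π₁ * Z i + η i ω)
    (hindep : iIndepFun (fun i ω => (ε i ω, η i ω)) P)
    (hident : ∀ i, IdentDistrib (fun ω => (ε i ω, η i ω)) (fun ω => (ε 0 ω, η 0 ω)) P P)
    (hε : MemLp (ε 0) 2 P) (hη : MemLp (η 0) 2 P)
    (hZ_mean : Tendsto (fun n : ℕ => (∑ i ∈ Finset.range n, Z i) / (n : ℝ)) atTop (𝓝 0))
    (hZ_sq : Tendsto (fun n : ℕ => (∑ i ∈ Finset.range n, Z i ^ 2) / (n : ℝ)) atTop (𝓝 1))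
    {lam : ℕ → ℝ} (hlam : lam =o[atTop] fun n : ℕ => √(n : ℝ)) :
    TendstoInDistribution
      (fun (n : ℕ) ω =>
        √(n : ℝ) * (ridgeIV n (lam n) (fun i => Y i ω) (fun i => D i ω) Z - β₁))
      atTop id (fun _ => P) (gaussianReal 0 (Var[ε 0; P] / π₁ ^ 2).toNNReal) := by
  -- The limit theorems need centred errors; `hcenter` below removes the subtracted means again.
  set ε' : ℕ → Ω → ℝ := fun i ω => ε i ω - P[ε 0] with hε'
  set η' : ℕ → Ω → ℝ := fun i ω => η i ω - P[η 0] with hη'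
  have hε'L : MemLp (ε' 0) 2 P := hε.sub (memLp_const _)
  have hη'L : MemLp (η' 0) 2 P := hη.sub (memLp_const _)
  have hε'0 : P[ε' 0] = 0 := by
    simp [hε', integral_sub (hε.integrable (by norm_num)) (integrable_const _)]
  have hη'0 : P[η' 0] = 0 := by
    simp [hη', integral_sub (hη.integrable (by norm_num)) (integrable_const _)]
  have hε'i : iIndepFun ε' P := hindep.comp (fun _ (p : ℝ × ℝ) => p.1 - ∫ ω, ε 0 ω ∂P) fun _ => by fun_prop
  have hη'i : iIndepFun η' P := hindep.comp (fun _ (p : ℝ × ℝ) => p.2 - ∫ ω, η 0 ω ∂P) fun _ => by fun_prop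
  have hε'd : ∀ i, IdentDistrib (ε' i) (ε' 0) P P := fun i =>
    (hident i).comp (u := fun p : ℝ × ℝ => p.1 - ∫ ω, ε 0 ω ∂P) (by fun_prop)
  have hη'd : ∀ i, IdentDistrib (η' i) (η' 0) P P := fun i =>
    (hident i).comp (u := fun p : ℝ × ℝ => p.2 - ∫ ω, η 0 ω ∂P) (by fun_prop)
  have mε : ∀ i, AEMeasurable (ε i) P := fun i => (hident i).aemeasurable_fst.fst
  have mη : ∀ i, AEMeasurable (η i) P := fun i => (hident i).aemeasurable_fst.snd
  have mD : ∀ i, AEMeasurable (D i) P := fun i => by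
    rw [show D i = fun ω => π₀ + π₁ * Z i + η i ω from funext (hD i)]
    exact (mη i).const_add _
  have mY : ∀ i, AEMeasurable (Y i) P := fun i => by
    rw [show Y i = fun ω => β₀ + β₁ * D i ω + ε i ω from funext (hY i)]
    exact (((mD i).const_mul _).const_add _).add (mε i)
  have hvar : Var[ε' 0; P] = Var[ε 0; P] := variance_sub_const hε.aestronglyMeasurable _
  have hquad := tendsto_sum_sq_sub_sampleMean_div hZ_mean hZ_sq
  have hcenter : ∀ (n : ℕ) (r m : ℝ) (x : ℕ → ℝ),
      ∑ i ∈ Finset.range n, (Z i - sampleMean n Z) / r * (x i - m) =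
        ∑ i ∈ Finset.range n, (Z i - sampleMean n Z) / r * x i := fun n r m x => by
    simp only [mul_sub]
    rw [Finset.sum_sub_distrib, ← Finset.sum_mul, ← Finset.sum_div, sum_sub_sampleMean, zero_div,
      zero_mul, sub_zero]
  -- The numerator's limit is realised as `π₁ * x` on the target Gaussian space, so that division by
  -- `π₁` in Slutsky's theorem leaves `id`.
  have hG : HasLaw (fun x : ℝ => π₁ * x) (gaussianReal 0 Var[ε' 0; P].toNNReal)
      (gaussianReal 0 (Var[ε 0; P] / π₁ ^ 2).toNNReal) := by
    refine ⟨by fun_prop, ?_⟩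
    rw [gaussianReal_map_const_mul, mul_zero, hvar]
    congr 1
    ext
    have := variance_nonneg (ε 0) P
    rw [NNReal.coe_mul, Real.coe_toNNReal _ (by positivity), Real.coe_toNNReal _ this]
    simp [field]
  have hnum := tendstoInDistribution_weighted_sum hG hε'L hε'0 hε'i hε'd
    (a := fun n i => (Z i - sampleMean n Z) / √n) (by
      refine hquad.congr fun n => ?_
      simp only [div_pow, Real.sq_sqrt (Nat.cast_nonneg n), Finset.sum_div])
    (eventually_abs_sub_sampleMean_div_sqrt_le hZ_mean hZ_sq)
  have hden := tendstoInMeasure_weighted_sum hη'L hη'0 hη'i hη'd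
    (a := fun n i => (Z i - sampleMean n Z) / n) (by
      -- The squared weights sum to `n⁻¹` times a convergent average.
      have := hquad.mul (tendsto_one_div_atTop_nhds_zero_nat (𝕜 := ℝ))
      rw [mul_zero] at this
      refine this.congr fun n => ?_
      simp only [div_pow, ← Finset.sum_div]
      rw [div_mul_div_comm, mul_one, pow_two])
  simp only [hε', hη', hcenter] at hnum hden
  have hlam' : Tendsto (fun n : ℕ => lam n / √(n : ℝ)) atTop (𝓝 0) := hlam.tendsto_div_nhds_zero
  have hlam_n : Tendsto (fun n : ℕ => lam n / (n : ℝ)) atTop (𝓝 0) := by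
    have hi : Tendsto (fun n : ℕ => (√(n : ℝ))⁻¹) atTop (𝓝 0) :=
      tendsto_inv_atTop_zero.comp (Real.tendsto_sqrt_atTop.comp tendsto_natCast_atTop_atTop)
    have := hlam'.mul hi
    rw [mul_zero] at this
    refine this.congr fun n => ?_
    rw [← div_eq_mul_inv, div_div, Real.mul_self_sqrt (Nat.cast_nonneg n)]
  -- The penalty's bias `-(λ_n / √n) β₁` vanishes; the full rate `o(√n)` is used here, while the
  -- denominator needs only `λ_n = o(n)`.
  have hX := hnum.add_of_tendstoInMeasure_const
    (tendstoInMeasure_const_of_tendsto (P := P) (hlam'.mul_const β₁).neg) fun _ => by fun_prop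
  have hdet : Tendsto (fun n : ℕ =>
      π₁ * ((∑ i ∈ Finset.range n, (Z i - sampleMean n Z) ^ 2) / n) + lam n / n) atTop
      (𝓝 π₁) := by
    simpa using (hquad.const_mul π₁).add hlam_n
  have hYm := hden.const_add_of_tendsto hdet
  have h := hX.div_of_tendstoInMeasure_const hπ₁ (by simpa using hYm) (fun n => ?_) (T :=
    fun (n : ℕ) ω =>
        √(n : ℝ) * (ridgeIV n (lam n) (fun i => Y i ω) (fun i => D i ω) Z - β₁))
    (fun n => ?_) ?_
  · convert! h using 2 with x
    simp [hπ₁]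
  · fun_prop
  · simp only [ridgeIV, sampleMean]
    fun_prop
  · filter_upwards [eventually_gt_atTop 0] with n hn ω h0
    exact sqrt_mul_ridgeIV_sub_eq_div hn (fun i => hY i ω) (fun i => hD i ω) h0

end RidgeIV

lemma ridgeIV_zero (n : ℕ) (y d z : ℕ → ℝ) : ridgeIV n 0 y d z = tsls n y d z := by
  rw [ridgeIV, tsls, add_zero]

theorem mainTheorem2 {Ω : Type*} [MeasurableSpace Ω] (P : Measure Ω) [IsProbabilityMeasure P]
    (β₀ β₁ π₀ π₁ : ℝ) (hπ₁ : π₁ ≠ 0)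
    (Z : ℕ → ℝ) (ε η Y D : ℕ → Ω → ℝ)
    (hY : ∀ i ω, Y i ω = β₀ + β₁ * D i ω + ε i ω)
    (hD : ∀ i ω, D i ω = π₀ + π₁ * Z i + η i ω)
    (hindep : iIndepFun (fun i ω => (ε i ω, η i ω)) P)
    (hident : ∀ i, IdentDistrib (fun ω => (ε i ω, η i ω)) (fun ω => (ε 0 ω, η 0 ω)) P P)
    (hε : MemLp (ε 0) 2 P) (hη : MemLp (η 0) 2 P)
    (hZ_mean : Tendsto (fun n : ℕ => (∑ i ∈ Finset.range n, Z i) / (n : ℝ)) atTop (𝓝 0))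
    (hZ_sq : Tendsto (fun n : ℕ => (∑ i ∈ Finset.range n, Z i ^ 2) / (n : ℝ)) atTop (𝓝 1))
    (lam : ℕ → ℝ) (hlam : lam =o[atTop] fun n : ℕ => √(n : ℝ)) :
    TendstoInDistribution
        (fun (n : ℕ) ω =>
          √(n : ℝ) * (ridgeIV n (lam n) (fun i => Y i ω) (fun i => D i ω) Z - β₁))
        atTop id (fun _ => P) (gaussianReal 0 (Var[ε 0; P] / π₁ ^ 2).toNNReal) ∧
      TendstoInDistribution
        (fun (n : ℕ) ω =>
          √(n : ℝ) * (tsls n (fun i => Y i ω) (fun i => D i ω) Z - β₁))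
        atTop id (fun _ => P) (gaussianReal 0 (Var[ε 0; P] / π₁ ^ 2).toNNReal) := by
  refine ⟨tendstoInDistribution_sqrt_mul_ridgeIV_sub hπ₁ hY hD hindep hident hε hη hZ_mean hZ_sq
    hlam, ?_⟩
  simpa only [ridgeIV_zero] using tendstoInDistribution_sqrt_mul_ridgeIV_sub hπ₁ hY hD hindep
    hident hε hη hZ_mean hZ_sq (isLittleO_zero (E' := ℝ) _ _)
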